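/- Let $p$ be a prime with $p\equiv 3 \pmod 4$, put $\Delta=4p$ and $D=|\Delta|=4p$, and let $\left(\frac{\Delta}{a}\right)$ denote the Kronecker symbol. Let $$F_\Delta(x)=\sum_{a=1}^{D-1}\left(\frac{\Delta}{a}\right)x^a,\qquad \tilde F_\Delta(x)=\sum_{a=0}^{D/2-1}\left(\frac{\Delta}{2a+1}\right)x^a,$$ so that $F_\Delta(x)=x\,\tilde F_\Delta(x^2)$. Write $\Phi_n$ for the $n$-th cyclotomic polynomial, $r_\Delta(\Phi_n)$ for the exact multiplicity of $\Phi_n$ as a factor of $F_\Delta$ in $\mathbb{Z}[x]$, and $\tilde r_\Delta(\Phi_n)$ for the exact multiplicity of $\Phi_n$ as a factor of $\tilde F_\Delta$. Then $$r_\Delta(\Phi_4)=\tilde r_\Delta(\Phi_2)=\begin{cases}3 & \text{if } p\equiv 7 \pmod 8,\\ 1 & \text{if } p\equiv 3\pmod 8.\end{cases}$$ Moreover, if $p\equiv 7\pmod 8$, then $$\tilde F_\Delta'''(-1)=\tfrac32\,p\,B_{3,\chi}\neq 0,$$ where $\chi=\left(\frac{\cdot}{p}\right)$ is the Legendre symbol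 modulo $p$ and the generalized Bernoulli numbers $B_{n,\chi}$ are defined by $$\sum_{a=1}^{p}\frac{\chi(a)\,t\,e^{at}}{e^{pt}-1}=\sum_{n\ge 0}B_{n,\chi}\frac{t^n}{n!}.$$ -/

import Mathlib

open Polynomial

namespace Fekete

/-- The symbol `(a / q)` for a prime `q`: the Legendre symbol when `q` is odd, and for `q = 2`
the value `0`, `1`, `-1` according to `a` even, `a ≡ ±1 (mod 8)`, `a ≡ ±3 (mod 8)`.
(For an odd prime `q`, Mathlib's `jacobiSym a q` is the Legendre symbol.) -/
def primeSym (a : ℤ) (q : ℕ) : ℤ :=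
  if q = 2 then ZMod.χ₈ (a : ZMod 8) else jacobiSym a q

/-- The Kronecker symbol `(a / n)` for arbitrary integers `a` and `n`. -/
def kroneckerSym (a n : ℤ) : ℤ :=
  if n = 0 then (if a = 1 ∨ a = -1 then 1 else 0)
  else (if n < 0 ∧ a < 0 then -1 else 1) *
    n.natAbs.factorization.prod fun q e => primeSym a q ^ e

/-- The generalized Fekete polynomial
`F_Δ(x) = ∑_{a=1}^{D-1} (Δ / a) x^a`, where `D = |Δ|`. -/
noncomputable def feketePoly (Δ : ℤ) : ℤ[X] :=
  ∑ a ∈ Finset.Ico 1 Δ.natAbs, C (kroneckerSym Δ a) * X ^ a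

/-- The modified Fekete polynomial of an even `Δ`:
`F̃_Δ(x) = ∑_{a=0}^{D/2-1} (Δ / (2a+1)) x^a`, where `D = |Δ|`. -/
noncomputable def modifiedFeketePoly (Δ : ℤ) : ℤ[X] :=
  ∑ a ∈ Finset.range (Δ.natAbs / 2), C (kroneckerSym Δ (2 * a + 1)) * X ^ a

/-- For even `Δ` the Kronecker symbol `(Δ / a)` vanishes at even `a ≠ 0`. -/
theorem kroneckerSym_even {Δ : ℤ} (hΔ : Even Δ) {n : ℕ} (hn : n ≠ 0) :
    kroneckerSym Δ ((2 * n : ℕ) : ℤ) = 0 := by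
  have h0 : (2 * n : ℕ) ≠ 0 := by omega
  have h2 : 2 ∈ (2 * n).factorization.support := by
    rw [Nat.support_factorization, Nat.mem_primeFactors]
    exact ⟨Nat.prime_two, dvd_mul_right _ _, h0⟩
  unfold kroneckerSym
  rw [if_neg (by exact_mod_cast h0), Int.natAbs_natCast, Finsupp.prod,
    Finset.prod_eq_zero h2, mul_zero]
  have h3 : primeSym Δ 2 = 0 := by
    rw [primeSym, if_pos rfl, ZMod.χ₈_int_eq_if_mod_eight, if_pos (Int.even_iff.mp hΔ)]
  rw [h3]
  exact zero_pow (Finsupp.mem_support_iff.mp h2)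

/-- The defining relation `F_Δ(x) = x F̃_Δ(x²)` for even `Δ`. -/
theorem feketePoly_eq {Δ : ℤ} (hΔ : Even Δ) :
    feketePoly Δ = X * (modifiedFeketePoly Δ).comp (X ^ 2) := by
  obtain ⟨m, hm⟩ : Even Δ.natAbs := Int.natAbs_even.mpr hΔ
  have key : ∀ k : ℕ, ∑ a ∈ Finset.Ico 1 (k + k), C (kroneckerSym Δ a) * X ^ a
      = X * (∑ a ∈ Finset.range k, C (kroneckerSym Δ (2 * a + 1)) * X ^ a).comp (X ^ 2) := by
    intro k
    induction k with
    | zero => simp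
    | succ k ih =>
      rcases Nat.eq_zero_or_pos k with rfl | hk
      · simp [mul_comm]
      · rw [show k + 1 + (k + 1) = (k + k + 1) + 1 by ring, Finset.sum_Ico_succ_top (by omega),
          Finset.sum_Ico_succ_top (by omega), ih, Finset.sum_range_succ]
        have h := kroneckerSym_even hΔ (n := k) (by omega)
        rw [show k + k = 2 * k by ring, h]
        simp [mul_add]
        ring
  unfold feketePoly modifiedFeketePoly
  rw [hm, key, show (m + m) / 2 = m by omega]

/-- The power series `(e^{ft} - 1) / t = ∑ f^{n+1} t^n / (n+1)!`. -/
noncomputable def expSubOneDiv (f : ℕ) : PowerSeries ℚ :=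
  PowerSeries.mk fun n => (f : ℚ) ^ (n + 1) / ((n + 1).factorial : ℚ)

/-- The generalized Bernoulli number `B_{n,χ}` of a (primitive) rational-valued Dirichlet
character `χ` modulo `f`, defined by the identity of power series
`∑_{a=1}^{f} χ(a) t e^{at} / (e^{ft} - 1) = ∑_n B_{n,χ} t^n / n!`. -/
noncomputable def genBernoulli (f : ℕ) (χ : DirichletCharacter ℚ f) (n : ℕ) : ℚ :=
  (n.factorial : ℚ) * PowerSeries.coeff n
    ((∑ a ∈ Finset.Icc 1 f,
      PowerSeries.C (χ (a : ZMod f)) * PowerSeries.rescale (a : ℚ) (PowerSeries.exp ℚ)) *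
      (expSubOneDiv f)⁻¹)

/-- The Legendre symbol `(· / p)` as a rational-valued Dirichlet character modulo `p`. -/
noncomputable def legendreChar (p : ℕ) [Fact p.Prime] : DirichletCharacter ℚ p :=
  (quadraticChar (ZMod p)).ringHomComp (Int.castRingHom ℚ)

end Fekete

namespace Fekete

/-! Quadratic reciprocity turns the coefficient (4p / (2a+1)) into (-1)^a χ(2a+1). At x = -1 the
signs cancel, so derivatives of F̃ there are combinations of moments of χ over odd m < 4p. Splitting
off even m and using periodicity reduces these to M_k = ∑_{a<p} χ(a) a^k, with M_0 = 0 and, χ being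
odd, M_2 = p M_1.

The value at -1 vanishes, and the first two derivatives carry the factor 1 - χ(2). For p ≡ 3 (mod 8)
the first is -4 M_1, nonzero because M_1 is odd. For p ≡ 7 both vanish and the third is (3/2)(M_3 -
p² M_1) = (3/2) p B_{3,χ}. The Fourier series of the Bernoulli polynomial B_3(x) makes B_{3,χ} a
nonzero multiple of L(3, χ) times the imaginary part of the Gauss sum, both nonzero. -/

theorem kroneckerSym_odd (a : ℤ) {n : ℕ} (hn : Odd n) :
    kroneckerSym a (n : ℤ) = jacobiSym a n := by
  have hn0 : n ≠ 0 := hn.pos.ne'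
  have hsym (q : ℕ) (hq : q ∈ n.factorization.support) : primeSym a q = jacobiSym a q := by
    have hq2 : q ≠ 2 := by
      rintro rfl
      rw [Nat.support_factorization, Nat.mem_primeFactors] at hq
      exact (Nat.not_even_iff_odd.mpr hn) (even_iff_two_dvd.mpr hq.2.1)
    rw [primeSym, if_neg hq2]
  have hprod (s : Finset ℕ) (f : ℕ → ℕ) (hs : ∀ q ∈ s, q ≠ 0) :
      jacobiSym a (∏ q ∈ s, q ^ f q) = ∏ q ∈ s, jacobiSym a q ^ f q := by
    induction s using Finset.induction_on with
    | empty => simp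
    | insert q s hq ih =>
      rw [Finset.prod_insert hq, Finset.prod_insert hq, jacobiSym.mul_right', jacobiSym.pow_right,
        ih fun r hr => hs r (Finset.mem_insert_of_mem hr)]
      · exact pow_ne_zero _ (hs q (Finset.mem_insert_self _ _))
      · exact Finset.prod_ne_zero_iff.mpr fun r hr =>
          pow_ne_zero _ (hs r (Finset.mem_insert_of_mem hr))
  have hpos : ∀ q ∈ n.factorization.support, q ≠ 0 := by
    intro q hq
    rw [Nat.support_factorization] at hq
    exact (Nat.prime_of_mem_primeFactors hq).ne_zero
  rw [kroneckerSym, if_neg (by exact_mod_cast hn0), if_neg (by omega), one_mul,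
    Int.natAbs_natCast, Finsupp.prod, Finset.prod_congr rfl fun q hq => by rw [hsym q hq],
    ← hprod _ _ hpos]
  congr 1
  exact Nat.prod_factorization_pow_eq_self hn0

/-! ### Reciprocity and moments of the Legendre symbol -/

section
variable (p : ℕ) [Fact p.Prime]

/-- The Legendre symbol `(n / p)` of a natural number, as an integer. -/
def legendreNat (n : ℕ) : ℤ := quadraticChar (ZMod p) (n : ZMod p)

theorem legendreNat_mul (m n : ℕ) : legendreNat p (m * n) = legendreNat p m * legendreNat p n := by
  rw [legendreNat, Nat.cast_mul, map_mul, legendreNat, legendreNat]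

theorem legendreNat_add_mul (a j : ℕ) : legendreNat p (a + j * p) = legendreNat p a := by
  simp [legendreNat]

theorem legendreNat_eq_jacobiSym (n : ℕ) : legendreNat p n = jacobiSym n p := by
  rw [← jacobiSym.legendreSym.to_jacobiSym, legendreSym, legendreNat, Int.cast_natCast]

variable {p} (hp : p % 4 = 3)
include hp

theorem kroneckerSym_four_mul (a : ℕ) :
    kroneckerSym (4 * (p : ℤ)) (2 * a + 1) = (-1) ^ a * legendreNat p (2 * a + 1) := by
  have hodd : Odd (2 * a + 1) := ⟨a, rfl⟩
  have h := kroneckerSym_odd (4 * (p : ℤ)) hodd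
  push_cast at h
  rw [h, jacobiSym.mul_left, jacobiSym.at_four hodd, one_mul, legendreNat_eq_jacobiSym]
  have hpo : Odd p := Nat.odd_iff.mpr (by omega)
  rcases Nat.even_or_odd a with ha | ha
  · rw [ha.neg_one_pow, one_mul]
    obtain ⟨b, rfl⟩ := ha
    exact (jacobiSym.quadratic_reciprocity_one_mod_four (by omega) hpo).symm
  · rw [ha.neg_one_pow, neg_one_mul]
    obtain ⟨b, rfl⟩ := ha
    exact jacobiSym.quadratic_reciprocity_three_mod_four hp (by omega)

theorem quadraticChar_neg_one_of_mod_four : quadraticChar (ZMod p) (-1) = -1 := by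
  have h2 : p ≠ 2 := by omega
  rw [quadraticChar_neg_one (by rwa [ZMod.ringChar_zmod_n]), ZMod.card,
    ZMod.χ₄_nat_three_mod_four hp]

theorem legendreNat_two_of_mod_eight_seven (h : p % 8 = 7) : legendreNat p 2 = 1 := by
  have hpo : Odd p := Nat.odd_iff.mpr (by omega)
  rw [legendreNat_eq_jacobiSym, Nat.cast_ofNat, jacobiSym.at_two hpo, ZMod.χ₈_nat_eq_if_mod_eight]
  simp [h]; omega

theorem legendreNat_two_of_mod_eight_three (h : p % 8 = 3) : legendreNat p 2 = -1 := by
  have hpo : Odd p := Nat.odd_iff.mpr (by omega)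
  rw [legendreNat_eq_jacobiSym, Nat.cast_ofNat, jacobiSym.at_two hpo, ZMod.χ₈_nat_eq_if_mod_eight]
  simp [h]; omega

omit hp
variable (p)

/-- The moments `∑_{0 ≤ a < N} (a / p) a ^ k`. -/
def moment (N k : ℕ) : ℤ := ∑ a ∈ Finset.range N, legendreNat p a * (a : ℤ) ^ k

/-- The moments `∑ (m / p) m ^ k` over the odd `0 < m < 2N`. -/
def oddMoment (N k : ℕ) : ℤ :=
  ∑ a ∈ Finset.range N, legendreNat p (2 * a + 1) * (2 * (a : ℤ) + 1) ^ k

/-- The even terms m = 2a contribute χ(2a)(2a)^k = 2^k χ(2) · χ(a) a^k. -/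
theorem oddMoment_eq (N k : ℕ) :
    oddMoment p N k = moment p (2 * N) k - 2 ^ k * legendreNat p 2 * moment p N k := by
  induction N with
  | zero => simp [oddMoment, moment]
  | succ N ih =>
    unfold oddMoment moment at *
    rw [show 2 * (N + 1) = 2 * N + 1 + 1 by ring]
    simp only [Finset.sum_range_succ, ih, legendreNat_mul, mul_add]
    push_cast
    ring

theorem moment_succ_mul (N k : ℕ) :
    moment p ((N + 1) * p) k = moment p (N * p) k +
      ∑ a ∈ Finset.range p, legendreNat p a * ((a : ℤ) + N * p) ^ k := by
  unfold moment
  rw [add_one_mul, Finset.sum_range_add]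
  congr 1
  refine Finset.sum_congr rfl fun a _ => ?_
  rw [add_comm (N * p), legendreNat_add_mul]
  push_cast
  rfl

theorem moment_succ_mul_one (N : ℕ) :
    moment p ((N + 1) * p) 1 = moment p (N * p) 1 + moment p p 1 + N * p * moment p p 0 := by
  rw [moment_succ_mul, add_assoc]
  congr 1
  unfold moment
  rw [Finset.mul_sum, ← Finset.sum_add_distrib]
  exact Finset.sum_congr rfl fun a _ => by ring

theorem moment_succ_mul_two (N : ℕ) :
    moment p ((N + 1) * p) 2 = moment p (N * p) 2 + (moment p p 2 + 2 * N * p * moment p p 1 +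
      (N * p) ^ 2 * moment p p 0) := by
  rw [moment_succ_mul]
  congr 1
  unfold moment
  rw [Finset.mul_sum, Finset.mul_sum, ← Finset.sum_add_distrib, ← Finset.sum_add_distrib]
  exact Finset.sum_congr rfl fun a _ => by ring

theorem moment_succ_mul_three (N : ℕ) :
    moment p ((N + 1) * p) 3 = moment p (N * p) 3 + (moment p p 3 + 3 * N * p * moment p p 2 +
      3 * (N * p) ^ 2 * moment p p 1 + (N * p) ^ 3 * moment p p 0) := by
  rw [moment_succ_mul]
  congr 1
  unfold moment
  simp only [Finset.mul_sum, ← Finset.sum_add_distrib]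
  exact Finset.sum_congr rfl fun a _ => by ring

theorem moment_zero_right_succ_mul (N : ℕ) :
    moment p ((N + 1) * p) 0 = moment p (N * p) 0 + moment p p 0 := by
  rw [moment_succ_mul]
  simp [moment]

theorem sum_zmod_eq_sum_range {M : Type*} [AddCommMonoid M] (f : ZMod p → M) :
    ∑ a, f a = ∑ a ∈ Finset.range p, f (a : ZMod p) := by
  refine Finset.sum_bij' (fun a _ => a.val) (fun a _ => (a : ZMod p)) ?_ ?_ ?_ ?_ ?_
  · exact fun a _ => Finset.mem_range.mpr a.val_lt
  · simp
  · simp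
  · exact fun a ha => ZMod.val_cast_of_lt (Finset.mem_range.mp ha)
  · simp

variable {p}

theorem moment_zero_right (h2 : p ≠ 2) : moment p p 0 = 0 := by
  have h := quadraticChar_sum_zero (F := ZMod p) (by rwa [ZMod.ringChar_zmod_n])
  rw [sum_zmod_eq_sum_range] at h
  simpa [moment, legendreNat] using h

include hp

/-- The reflection a ↦ p - a changes the sign of χ, so M_2 = -(p² M_0 - 2p M_1 + M_2), and M_0 = 0.
-/
theorem moment_two_right : moment p p 2 = p * moment p p 1 := by
  have hpos : 0 < p := (Fact.out : p.Prime).pos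
  have h0 : legendreNat p 0 = 0 := by simp [legendreNat]
  have key : moment p p 2 = ∑ a ∈ Finset.range p, -(legendreNat p a * ((p : ℤ) - a) ^ 2) := by
    -- Reflection preserves 1, …, p - 1; the term a = 0 is split off, as χ(0) = 0.
    obtain ⟨q, hq⟩ : ∃ q, p = q + 1 := ⟨p - 1, by omega⟩
    have hrange : Finset.range p = Finset.range (q + 1) := by rw [hq]
    rw [moment, hrange, Finset.sum_range_succ', Finset.sum_range_succ',
      ← Finset.sum_range_reflect, h0]
    simp only [zero_mul, neg_zero, add_zero]
    refine Finset.sum_congr rfl fun a ha => ?_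
    rw [Finset.mem_range] at ha
    have e : q - 1 - a + 1 = p - (a + 1) := by omega
    have hle : a + 1 ≤ p := by omega
    rw [e, Nat.cast_sub hle, legendreNat, Nat.cast_sub hle, CharP.cast_eq_zero, zero_sub,
      neg_eq_neg_one_mul, map_mul, quadraticChar_neg_one_of_mod_four hp, legendreNat]
    ring
  have expand : ∑ a ∈ Finset.range p, -(legendreNat p a * ((p : ℤ) - a) ^ 2) =
      -(p ^ 2 * moment p p 0) + 2 * p * moment p p 1 - moment p p 2 := by
    unfold moment
    simp only [Finset.mul_sum, ← Finset.sum_add_distrib, ← Finset.sum_neg_distrib,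
      ← Finset.sum_sub_distrib]
    exact Finset.sum_congr rfl fun a _ => by ring
  rw [expand, moment_zero_right (by omega)] at key
  linarith

/-- Modulo 2, χ(a) = ±1 may be dropped for 0 < a < p, leaving p(p-1)/2, which is odd for p ≡ 3 (mod
4). -/
theorem odd_moment_one : Odd (moment p p 1) := by
  have hmod : moment p p 1 ≡ ∑ a ∈ Finset.range p, (a : ℤ) [ZMOD 2] := by
    unfold moment
    refine (ZMod.intCast_eq_intCast_iff _ _ 2).mp ?_
    push_cast
    refine Finset.sum_congr rfl fun a ha => ?_
    rcases Nat.eq_zero_or_pos a with rfl | hpos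
    · simp
    · have hne : (a : ZMod p) ≠ 0 := by
        rw [Ne, ZMod.natCast_eq_zero_iff]
        exact fun h => absurd (Nat.le_of_dvd hpos h) (by simpa using ha)
      rcases quadraticChar_dichotomy hne with h | h <;> simp [legendreNat, h]
  have hsum : Odd (∑ a ∈ Finset.range p, (a : ℤ)) := by
    have h := Finset.sum_range_id_mul_two p
    obtain ⟨k, rfl⟩ : ∃ k, p = 4 * k + 3 := ⟨p / 4, by omega⟩
    have h' : ∑ i ∈ Finset.range (4 * k + 3), i = (4 * k + 3) * (2 * k + 1) := by
      rw [show 4 * k + 3 - 1 = 2 * (2 * k + 1) by omega] at h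
      nlinarith
    rw [← Nat.cast_sum, h', Int.odd_coe_nat]
    exact Odd.mul ⟨2 * k + 1, by ring⟩ ⟨k, rfl⟩
  rw [Int.odd_iff] at hsum ⊢
  rw [hmod.eq]
  exact hsum

theorem moment_mul_zero_right (N : ℕ) : moment p (N * p) 0 = 0 := by
  induction N with
  | zero => simp [moment]
  | succ N ih => rw [moment_zero_right_succ_mul, ih, moment_zero_right (by omega), add_zero]

theorem moment_mul_one_right (N : ℕ) : moment p (N * p) 1 = N * moment p p 1 := by
  induction N with
  | zero => simp [moment]
  | succ N ih =>
    rw [moment_succ_mul_one, ih, moment_zero_right (by omega)]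
    push_cast
    ring

theorem moment_mul_two_right (N : ℕ) : moment p (N * p) 2 = N ^ 2 * p * moment p p 1 := by
  induction N with
  | zero => simp [moment]
  | succ N ih =>
    rw [moment_succ_mul_two, ih, moment_two_right hp, moment_zero_right (by omega)]
    push_cast
    ring

theorem moment_mul_three_right (N : ℕ) :
    moment p (N * p) 3 = N * moment p p 3 + (N ^ 3 - N) * p ^ 2 * moment p p 1 := by
  induction N with
  | zero => simp [moment]
  | succ N ih =>
    rw [moment_succ_mul_three, ih, moment_two_right hp, moment_zero_right (by omega)]
    push_cast
    ring

theorem oddMoment_zero_right : oddMoment p (2 * p) 0 = 0 := by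
  rw [oddMoment_eq, ← mul_assoc, moment_mul_zero_right hp, moment_mul_zero_right hp, mul_zero,
    sub_zero]

theorem oddMoment_one_right :
    oddMoment p (2 * p) 1 = 4 * (1 - legendreNat p 2) * moment p p 1 := by
  rw [oddMoment_eq, ← mul_assoc, moment_mul_one_right hp, moment_mul_one_right hp]
  push_cast
  ring

theorem oddMoment_two_right :
    oddMoment p (2 * p) 2 = 16 * p * (1 - legendreNat p 2) * moment p p 1 := by
  rw [oddMoment_eq, ← mul_assoc, moment_mul_two_right hp, moment_mul_two_right hp]
  push_cast
  ring

theorem oddMoment_three_right (h2 : legendreNat p 2 = 1) :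
    oddMoment p (2 * p) 3 = 12 * (p ^ 2 * moment p p 1 - moment p p 3) := by
  rw [oddMoment_eq, ← mul_assoc, moment_mul_three_right hp, moment_mul_three_right hp, h2]
  push_cast
  ring

end

/-! ### The third generalized Bernoulli number in terms of moments -/

section

variable (p : ℕ) [Fact p.Prime]

theorem legendreChar_natCast (n : ℕ) : legendreChar p (n : ZMod p) = legendreNat p n := by
  simp [legendreChar, legendreNat, MulChar.ringHomComp_apply]

theorem sum_Icc_legendreChar (f : ℕ → ℚ) :
    ∑ a ∈ Finset.Icc 1 p, legendreChar p (a : ZMod p) * f a =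
      ∑ a ∈ Finset.range p, legendreChar p (a : ZMod p) * f a := by
  rw [← Finset.Ico_add_one_right_eq_Icc, Finset.sum_Ico_eq_sub _ (by omega),
    Finset.sum_range_succ]
  simp [legendreChar]

theorem coeff_sum_legendreChar_exp (n : ℕ) :
    PowerSeries.coeff n (∑ a ∈ Finset.Icc 1 p,
      PowerSeries.C (legendreChar p (a : ZMod p)) *
        PowerSeries.rescale (a : ℚ) (PowerSeries.exp ℚ)) =
      (moment p p n : ℚ) / n.factorial := by
  simp only [map_sum, PowerSeries.coeff_C_mul, PowerSeries.coeff_rescale, PowerSeries.coeff_exp]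
  rw [sum_Icc_legendreChar, moment]
  push_cast
  rw [Finset.sum_div]
  refine Finset.sum_congr rfl fun a _ => ?_
  rw [legendreChar_natCast]
  simp
  ring

/-- Multiplying by (e^{pt} - 1)/t and comparing coefficients up to t³ gives a triangular system. -/
theorem genBernoulli_three (h2 : p ≠ 2) :
    genBernoulli p (legendreChar p) 3 =
      moment p p 3 / p - 3 / 2 * moment p p 2 + p / 2 * moment p p 1 := by
  have hp0 : (p : ℚ) ≠ 0 := by exact_mod_cast (Fact.out : p.Prime).ne_zero
  set P := ∑ a ∈ Finset.Icc 1 p, PowerSeries.C (legendreChar p (a : ZMod p)) *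
    PowerSeries.rescale (a : ℚ) (PowerSeries.exp ℚ) with hP
  have hc : PowerSeries.constantCoeff (expSubOneDiv p) ≠ 0 := by
    rw [← PowerSeries.coeff_zero_eq_constantCoeff_apply, expSubOneDiv, PowerSeries.coeff_mk]
    simpa using hp0
  have hR : P * (expSubOneDiv p)⁻¹ * expSubOneDiv p = P := by
    rw [mul_assoc, PowerSeries.inv_mul_cancel _ hc, mul_one]
  have hB : genBernoulli p (legendreChar p) 3 =
      6 * PowerSeries.coeff 3 (P * (expSubOneDiv p)⁻¹) := by
    simp [genBernoulli, hP, Nat.factorial]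
  rw [hB]
  set R := P * (expSubOneDiv p)⁻¹
  have h (n : ℕ) : PowerSeries.coeff n (R * expSubOneDiv p) = (moment p p n : ℚ) / n.factorial := by
    rw [hR, hP, coeff_sum_legendreChar_exp]
  have e0 := h 0
  have e1 := h 1
  have e2 := h 2
  have e3 := h 3
  simp only [PowerSeries.coeff_mul, Finset.Nat.sum_antidiagonal_eq_sum_range_succ_mk,
    Finset.sum_range_succ, Finset.sum_range_zero, expSubOneDiv, PowerSeries.coeff_mk,
    Nat.factorial, moment_zero_right h2] at e0 e1 e2 e3
  norm_num [hp0] at e0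
  norm_num [e0] at e1 e2 e3
  field_simp at e1 e2 e3 ⊢
  have e2' : (PowerSeries.coeff 2 R) * p * 2 = moment p p 2 - p * moment p p 1 := by
    linear_combination e2 - p * e1
  linear_combination e3 - 3 * p * e2' - 2 * p * p * e1

end

/-! ### Nonvanishing of B_{3,χ} -/

section

theorem bernoulli_three_eval (x : ℝ) :
    ((Polynomial.bernoulli 3).map (algebraMap ℚ ℝ)).eval x = x ^ 3 - 3 / 2 * x ^ 2 + x / 2 := by
  simp [Polynomial.bernoulli, Finset.sum_range_succ, bernoulli_eq_bernoulli'_of_ne_one, Nat.choose]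
  ring

variable (p : ℕ) [Fact p.Prime]

/-- The Legendre symbol modulo `p` as a complex Dirichlet character. -/
noncomputable def legendreCharComplex : DirichletCharacter ℂ p :=
  (quadraticChar (ZMod p)).ringHomComp (Int.castRingHom ℂ)

theorem legendreCharComplex_natCast (n : ℕ) :
    legendreCharComplex p (n : ZMod p) = legendreNat p n := by
  simp [legendreCharComplex, legendreNat, MulChar.ringHomComp_apply]

theorem legendreCharComplex_isQuadratic : (legendreCharComplex p).IsQuadratic :=
  (quadraticChar_isQuadratic (ZMod p)).comp _

/-- The Gauss sum of the Legendre symbol in terms of sines. -/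
noncomputable def sineSum (n : ℕ) : ℝ :=
  ∑ a ∈ Finset.range p, legendreNat p a * Real.sin (2 * Real.pi * n * (a / p))

theorem im_gaussSum_mulShift (n : ℕ) :
    (gaussSum (legendreCharComplex p) (ZMod.stdAddChar.mulShift (n : ZMod p))).im =
      sineSum p n := by
  rw [gaussSum, sum_zmod_eq_sum_range, Complex.im_sum, sineSum]
  refine Finset.sum_congr rfl fun a _ => ?_
  have h := ZMod.stdAddChar_coe (N := p) ((n * a : ℕ) : ℤ)
  rw [Int.cast_natCast, Nat.cast_mul] at h
  rw [AddChar.mulShift_apply, h, legendreCharComplex_natCast,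
    show (2 * (Real.pi : ℂ) * Complex.I * ((n * a : ℕ) : ℤ) / p) =
      ((2 * Real.pi * n * (a / p) : ℝ) : ℂ) * Complex.I by push_cast; ring]
  rw [← Complex.ofReal_intCast, Complex.im_ofReal_mul, Complex.exp_ofReal_mul_I_im]

variable {p}

theorem sineSum_eq (h2 : p ≠ 2) (n : ℕ) : sineSum p n = legendreNat p n * sineSum p 1 := by
  have hq := legendreCharComplex_isQuadratic p
  rw [← im_gaussSum_mulShift, ← im_gaussSum_mulShift, Nat.cast_one, AddChar.mulShift_one]
  by_cases hn : (n : ZMod p) = 0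
  · have h0 : legendreNat p n = 0 := by rw [legendreNat, hn, MulChar.map_zero]
    rw [im_gaussSum_mulShift, h0, Int.cast_zero, zero_mul, ← im_gaussSum_mulShift, hn]
    have h := moment_zero_right (p := p) h2
    simp only [moment, pow_zero, mul_one] at h
    rw [gaussSum, sum_zmod_eq_sum_range]
    simp only [AddChar.mulShift_zero, AddChar.one_apply, mul_one, legendreCharComplex_natCast]
    rw [← Int.cast_sum, h]
    simp
  · have h := gaussSum_mulShift_eq (legendreCharComplex p) ZMod.stdAddChar (Units.mk0 _ hn)
    rw [hq.inv, Units.val_mk0, legendreCharComplex_natCast] at h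
    rw [h, ← Complex.ofReal_intCast, Complex.im_ofReal_mul]

/-- The Gauss sum has square χ(-1) p = -p < 0, so it cannot be real. -/
theorem sineSum_one_ne_zero (hp : p % 4 = 3) : sineSum p 1 ≠ 0 := by
  have h2 : p ≠ 2 := by omega
  have hneg : legendreCharComplex p (-1) = -1 := by
    simp only [legendreCharComplex, MulChar.ringHomComp_apply,
      quadraticChar_neg_one_of_mod_four hp]
    simp
  have hne : legendreCharComplex p ≠ 1 := by
    intro h
    rw [h, MulChar.one_apply isUnit_one.neg] at hneg
    norm_num at hneg
  have hsq := gaussSum_sq hne (legendreCharComplex_isQuadratic p) (ZMod.isPrimitive_stdAddChar p)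
  rw [hneg, ZMod.card] at hsq
  intro h
  rw [← im_gaussSum_mulShift, Nat.cast_one, AddChar.mulShift_one] at h
  have hre := congrArg Complex.re hsq
  rw [pow_two, Complex.mul_re, h] at hre
  have hpos : (0 : ℝ) < p := by exact_mod_cast (Fact.out : p.Prime).pos
  simp at hre
  nlinarith [mul_self_nonneg (gaussSum (legendreCharComplex p) ZMod.stdAddChar).re]

theorem tsum_legendreNat_div_cube_ne_zero :
    ∑' n : ℕ, (legendreNat p n : ℝ) / (n : ℝ) ^ 3 ≠ 0 := by
  intro h
  refine DirichletCharacter.LSeries_ne_zero_of_one_lt_re (legendreCharComplex p) (s := 3)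
    (by norm_num) ?_
  rw [LSeries]
  have key (n : ℕ) : LSeries.term (fun n => legendreCharComplex p n) 3 n =
      (((legendreNat p n : ℝ) / (n : ℝ) ^ 3 : ℝ) : ℂ) := by
    rw [LSeries.term_def]
    split_ifs with hn
    · simp [hn]
    · rw [legendreCharComplex_natCast]
      push_cast
      congr 1
      exact_mod_cast Complex.cpow_natCast (n : ℂ) 3
  rw [tsum_congr key, ← Complex.ofReal_tsum, h, Complex.ofReal_zero]

/-- Weighting the sine series of B_3(a/p) by χ(a) and summing over a yields L(3, χ) · `sineSum p 1`
on one side and a multiple of B_{3,χ} on the other. -/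
theorem genBernoulli_three_ne_zero (hp : p % 4 = 3) :
    genBernoulli p (legendreChar p) 3 ≠ 0 := by
  intro hB
  have hp0 : (p : ℝ) ≠ 0 := by exact_mod_cast (Fact.out : p.Prime).ne_zero
  have h2 : p ≠ 2 := by omega
  rw [genBernoulli_three p h2] at hB
  have hB' : (moment p p 3 : ℝ) / p - 3 / 2 * moment p p 2 + p / 2 * moment p p 1 = 0 := by
    have h := congrArg (Rat.cast : ℚ → ℝ) hB
    push_cast at h
    exact h
  have hsum : HasSum (fun n : ℕ => (legendreNat p n : ℝ) / (n : ℝ) ^ 3 * sineSum p 1)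
      (∑ a ∈ Finset.range p, legendreNat p a * ((-1 : ℝ) ^ (1 + 1) * (2 * Real.pi) ^ (2 * 1 + 1) / 2 /
        (2 * 1 + 1).factorial * ((Polynomial.bernoulli (2 * 1 + 1)).map (algebraMap ℚ ℝ)).eval
          ((a : ℝ) / p))) := by
    have h := hasSum_sum (s := Finset.range p) fun a ha =>
      (hasSum_one_div_nat_pow_mul_sin one_ne_zero (x := (a : ℝ) / p) ⟨by positivity,
        div_le_one_of_le₀ (by exact_mod_cast (Finset.mem_range.mp ha).le)
          (by positivity)⟩).mul_left (legendreNat p a : ℝ)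
    refine h.congr_fun ?_
    intro n
    rw [div_mul_eq_mul_div, ← sineSum_eq h2, sineSum, Finset.sum_div]
    exact Finset.sum_congr rfl fun a _ => by ring
  have hzero : ∑ a ∈ Finset.range p, (legendreNat p a : ℝ) *
      ((a / p : ℝ) ^ 3 - 3 / 2 * (a / p : ℝ) ^ 2 + (a / p : ℝ) / 2) = 0 := by
    have : ∑ a ∈ Finset.range p, (legendreNat p a : ℝ) *
        ((a / p : ℝ) ^ 3 - 3 / 2 * (a / p : ℝ) ^ 2 + (a / p : ℝ) / 2) =
        ((moment p p 3 : ℝ) / p - 3 / 2 * moment p p 2 + p / 2 * moment p p 1) / p ^ 2 := by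
      simp only [moment]
      push_cast
      simp only [Finset.mul_sum, Finset.sum_div, ← Finset.sum_add_distrib,
        ← Finset.sum_sub_distrib]
      refine Finset.sum_congr rfl fun a _ => ?_
      field_simp
    rw [this, hB', zero_div]
  have hval : (∑ a ∈ Finset.range p, legendreNat p a * ((-1 : ℝ) ^ (1 + 1) *
      (2 * Real.pi) ^ (2 * 1 + 1) / 2 / (2 * 1 + 1).factorial *
        ((Polynomial.bernoulli (2 * 1 + 1)).map (algebraMap ℚ ℝ)).eval ((a : ℝ) / p))) = 0 := by
    simp only [Nat.mul_one, Nat.reduceAdd, bernoulli_three_eval]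
    simp only [mul_left_comm (legendreNat p _ : ℝ), ← Finset.mul_sum, hzero, mul_zero]
  rw [hval] at hsum
  have h := hsum.tsum_eq
  rw [tsum_mul_right] at h
  exact (mul_ne_zero tsum_legendreNat_div_cube_ne_zero (sineSum_one_ne_zero hp)) h

end

/-! ### Multiplicities and derivatives at -1 -/

section

/-- If f = (X+1)^k g with g(-1) ≠ 0, the cofactor X g(X²) of (X²+1)^k takes the value i g(-1) ≠ 0 at
i. -/
theorem emultiplicity_X_sq_add_one (f : ℤ[X]) :
    emultiplicity (X ^ 2 + 1 : ℤ[X]) (X * f.comp (X ^ 2)) = emultiplicity (X + 1 : ℤ[X]) f := by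
  rcases eq_or_ne f 0 with rfl | hf
  · simp
  have hX : (X + 1 : ℤ[X]) = X - C (-1) := by simp
  obtain ⟨g, hfg, hg⟩ := exists_eq_pow_rootMultiplicity_mul_and_not_dvd f hf (-1)
  rw [← hX] at hfg hg
  set k := rootMultiplicity (-1) f
  have hk : emultiplicity (X + 1 : ℤ[X]) f = k := by
    refine emultiplicity_eq_of_dvd_of_not_dvd ⟨g, hfg⟩ ?_
    rintro ⟨q, hq⟩
    refine hg ⟨q, mul_left_cancel₀ (pow_ne_zero k (X_add_C_ne_zero 1)) ?_⟩
    rw [map_one, ← hfg, hq]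
    ring
  have hcomp : X * f.comp (X ^ 2) = (X ^ 2 + 1) ^ k * (X * g.comp (X ^ 2)) := by
    rw [hfg]
    simp
    ring
  have hne : (X ^ 2 + 1 : ℤ[X]) ≠ 0 := by
    have := (monic_X_pow_add_C (1 : ℤ) two_ne_zero).ne_zero
    simpa using this
  rw [hk]
  refine emultiplicity_eq_of_dvd_of_not_dvd ⟨_, hcomp⟩ ?_
  rintro ⟨q, hq⟩
  rw [hcomp, pow_succ (X ^ 2 + 1 : ℤ[X]), mul_assoc] at hq
  have hI := congrArg (aeval Complex.I) (mul_left_cancel₀ (pow_ne_zero k hne) hq)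
  have hgI : aeval (-1 : ℂ) g = 0 := by
    simpa [aeval_comp] using hI
  refine hg ?_
  rw [hX, dvd_iff_isRoot, IsRoot.def]
  have h : ((g.eval (-1) : ℤ) : ℂ) = 0 := by
    have h := aeval_algebraMap_apply_eq_algebraMap_eval (A := ℂ) (-1 : ℤ) g
    rw [map_neg, map_one, hgI] at h
    simpa using h.symm
  exact_mod_cast h

theorem iterate_derivative_sum_C_mul_X_pow (c : ℕ → ℤ) (N k : ℕ) (x : ℤ) :
    (derivative^[k] (∑ a ∈ Finset.range N, C (c a) * X ^ a)).eval x =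
      ∑ a ∈ Finset.range N, c a * (a.descFactorial k * x ^ (a - k)) := by
  simp [iterate_derivative_sum, iterate_derivative_X_pow_eq_natCast_mul,
    eval_finsetSum]

theorem emultiplicity_X_add_one_eq {f : ℤ[X]} {n : ℕ}
    (h : ∀ k < n, (derivative^[k] f).eval (-1) = 0) (hn : (derivative^[n] f).eval (-1) ≠ 0) :
    emultiplicity (X + 1 : ℤ[X]) f = n := by
  have hf : f ≠ 0 := by
    rintro rfl
    simp at hn
  have hX : (X + 1 : ℤ[X]) = X - C (-1) := by simp
  have hm : rootMultiplicity (-1) f = n := by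
    refine le_antisymm ?_ ?_
    · by_contra! hlt
      exact hn ((lt_rootMultiplicity_iff_isRoot_iterate_derivative hf).mp hlt n le_rfl)
    · rcases n with _ | n
      · exact Nat.zero_le _
      · exact (lt_rootMultiplicity_iff_isRoot_iterate_derivative hf).mpr
          fun m hm => h m (by omega)
  rw [hX, (finiteMultiplicity_X_sub_C (-1) hf).emultiplicity_eq_multiplicity, ← hm]
  classical
  rw [rootMultiplicity_eq_multiplicity, if_neg hf]

variable {p : ℕ} [Fact p.Prime] (hp : p % 4 = 3)
include hp

theorem eval_iterate_derivative_modifiedFeketePoly (k : ℕ) :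
    (derivative^[k] (modifiedFeketePoly (4 * (p : ℤ)))).eval (-1) =
      (-1) ^ k * ∑ a ∈ Finset.range (2 * p), legendreNat p (2 * a + 1) * a.descFactorial k := by
  have hD : (4 * (p : ℤ)).natAbs / 2 = 2 * p := by omega
  rw [modifiedFeketePoly, hD, iterate_derivative_sum_C_mul_X_pow
    (fun a => kroneckerSym (4 * (p : ℤ)) (2 * a + 1)), Finset.mul_sum]
  refine Finset.sum_congr rfl fun a _ => ?_
  rw [kroneckerSym_four_mul hp]
  -- For a < k the exponent a - k truncates, but the falling factorial is 0.
  rcases lt_or_ge a k with hak | hka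
  · simp [Nat.descFactorial_eq_zero_iff_lt.mpr hak]
  · obtain ⟨b, rfl⟩ := Nat.exists_eq_add_of_le hka
    have hb : ((-1 : ℤ) ^ b) * (-1) ^ b = 1 := by rw [← mul_pow]; simp
    rw [Nat.add_sub_cancel_left, pow_add]
    linear_combination (-1) ^ k * legendreNat p (2 * (k + b) + 1) *
      ((k + b).descFactorial k : ℤ) * hb

theorem eval_modifiedFeketePoly : (modifiedFeketePoly (4 * (p : ℤ))).eval (-1) = 0 := by
  have h := eval_iterate_derivative_modifiedFeketePoly hp 0
  have h0 := oddMoment_zero_right hp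
  simp only [oddMoment, pow_zero, mul_one] at h0
  simpa [h0] using h

theorem eval_derivative_modifiedFeketePoly :
    2 * (derivative (modifiedFeketePoly (4 * (p : ℤ)))).eval (-1) = -oddMoment p (2 * p) 1 := by
  have h := eval_iterate_derivative_modifiedFeketePoly hp 1
  have h0 := oddMoment_zero_right hp
  have key : oddMoment p (2 * p) 1 = 2 * ∑ a ∈ Finset.range (2 * p),
      legendreNat p (2 * a + 1) * a.descFactorial 1 + oddMoment p (2 * p) 0 := by
    simp only [oddMoment, Finset.mul_sum, ← Finset.sum_add_distrib]
    exact Finset.sum_congr rfl fun a _ => by simp; ring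
  rw [Function.iterate_one] at h
  rw [h, key, h0]
  ring

theorem eval_derivative_two_modifiedFeketePoly :
    4 * (derivative^[2] (modifiedFeketePoly (4 * (p : ℤ)))).eval (-1) =
      oddMoment p (2 * p) 2 - 4 * oddMoment p (2 * p) 1 := by
  have h0 := oddMoment_zero_right hp
  -- With m = 2a + 1, 4a(a-1) = (m-1)(m-3).
  have key : oddMoment p (2 * p) 2 - 4 * oddMoment p (2 * p) 1 + 3 * oddMoment p (2 * p) 0 =
      4 * ∑ a ∈ Finset.range (2 * p), legendreNat p (2 * a + 1) * a.descFactorial 2 := by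
    simp only [oddMoment, Finset.mul_sum, ← Finset.sum_add_distrib, ← Finset.sum_sub_distrib]
    refine Finset.sum_congr rfl fun a _ => ?_
    rcases a with _ | _ | a <;> simp [Nat.descFactorial] <;> ring
  rw [eval_iterate_derivative_modifiedFeketePoly hp]
  linear_combination 3 * h0 - key

theorem eval_derivative_three_modifiedFeketePoly :
    8 * (derivative^[3] (modifiedFeketePoly (4 * (p : ℤ)))).eval (-1) =
      -(oddMoment p (2 * p) 3 - 9 * oddMoment p (2 * p) 2 + 23 * oddMoment p (2 * p) 1) := by
  have h0 := oddMoment_zero_right hp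
  -- Likewise 8a(a-1)(a-2) = (m-1)(m-3)(m-5).
  have key : oddMoment p (2 * p) 3 - 9 * oddMoment p (2 * p) 2 + 23 * oddMoment p (2 * p) 1 -
      15 * oddMoment p (2 * p) 0 =
      8 * ∑ a ∈ Finset.range (2 * p), legendreNat p (2 * a + 1) * a.descFactorial 3 := by
    simp only [oddMoment, Finset.mul_sum, ← Finset.sum_add_distrib, ← Finset.sum_sub_distrib]
    refine Finset.sum_congr rfl fun a _ => ?_
    rcases a with _ | _ | _ | a <;> simp [Nat.descFactorial] <;> ring
  rw [eval_iterate_derivative_modifiedFeketePoly hp]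
  linear_combination key + 15 * h0

end

end Fekete

/-! ### The two classes of p modulo 8 -/

theorem mainTheorem6 (p : ℕ) [Fact p.Prime] (hp : p % 4 = 3) :
    (emultiplicity (cyclotomic 4 ℤ) (Fekete.feketePoly (4 * (p : ℤ))) =
        emultiplicity (cyclotomic 2 ℤ) (Fekete.modifiedFeketePoly (4 * (p : ℤ)))) ∧
      (p % 8 = 7 →
        emultiplicity (cyclotomic 2 ℤ) (Fekete.modifiedFeketePoly (4 * (p : ℤ))) = 3) ∧
      (p % 8 = 3 →
        emultiplicity (cyclotomic 2 ℤ) (Fekete.modifiedFeketePoly (4 * (p : ℤ))) = 1) ∧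
      (p % 8 = 7 →
        (((derivative^[3] (Fekete.modifiedFeketePoly (4 * (p : ℤ)))).eval (-1) : ℤ) : ℚ) =
            3 / 2 * (p : ℚ) * Fekete.genBernoulli p (Fekete.legendreChar p) 3 ∧
          Fekete.genBernoulli p (Fekete.legendreChar p) 3 ≠ 0) := by
  have hp0 : (p : ℚ) ≠ 0 := by exact_mod_cast (Fact.out : p.Prime).ne_zero
  have hc4 : cyclotomic 4 ℤ = X ^ 2 + 1 := by
    have h := cyclotomic_prime_pow_eq_geom_sum (R := ℤ) (n := 1) Nat.prime_two
    norm_num [Finset.sum_range_succ] at h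
    rw [h, add_comm]
  have hB := Fekete.genBernoulli_three_ne_zero hp
  have heval0 := Fekete.eval_modifiedFeketePoly hp
  have heval1 := Fekete.eval_derivative_modifiedFeketePoly hp
  have heval2 := Fekete.eval_derivative_two_modifiedFeketePoly hp
  have heval3 := Fekete.eval_derivative_three_modifiedFeketePoly hp
  have hodd1 := Fekete.oddMoment_one_right hp
  have hodd2 := Fekete.oddMoment_two_right hp
  have hthird (h7 : p % 8 = 7) :
      (((derivative^[3] (Fekete.modifiedFeketePoly (4 * (p : ℤ)))).eval (-1) : ℤ) : ℚ) =
        3 / 2 * (p : ℚ) * Fekete.genBernoulli p (Fekete.legendreChar p) 3 := by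
    have hχ2 := Fekete.legendreNat_two_of_mod_eight_seven hp h7
    rw [hodd1, hodd2, Fekete.oddMoment_three_right hp hχ2, hχ2] at heval3
    have h := congrArg (Int.cast : ℤ → ℚ) heval3
    push_cast at h
    rw [Fekete.genBernoulli_three p (by omega), Fekete.moment_two_right hp]
    push_cast
    field_simp
    linear_combination h / 2
  rw [hc4, cyclotomic_two, Fekete.feketePoly_eq ⟨2 * (p : ℤ), by ring⟩]
  refine ⟨Fekete.emultiplicity_X_sq_add_one _, fun h7 => ?_, fun h3 => ?_,
    fun h7 => ⟨hthird h7, hB⟩⟩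
  · have hχ2 := Fekete.legendreNat_two_of_mod_eight_seven hp h7
    rw [hχ2, sub_self, mul_zero, zero_mul] at hodd1 hodd2
    refine Fekete.emultiplicity_X_add_one_eq (n := 3) (fun k hk => ?_) fun h => ?_
    · interval_cases k
      · exact heval0
      · rw [Function.iterate_one]
        omega
      · omega
    · have h' := hthird h7
      rw [h, Int.cast_zero] at h'
      exact mul_ne_zero (mul_ne_zero (by norm_num) hp0) hB h'.symm
  · have hχ2 := Fekete.legendreNat_two_of_mod_eight_three hp h3
    rw [hχ2] at hodd1
    refine Fekete.emultiplicity_X_add_one_eq (n := 1) (fun k hk => ?_) fun h => ?_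
    · interval_cases k
      exact heval0
    · obtain ⟨m, hm⟩ := Fekete.odd_moment_one hp
      rw [Function.iterate_one] at h
      -- A zero derivative would force 8 M_1 = 0, against M_1 = 2m + 1.
      omega
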